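/- Let $p,q\ge 1$ be real numbers with $\frac1p+\frac1q>1$. There is a constant $C_{p,q}<\infty$, depending only on $p$ and $q$, such that the following holds for every $T>0$. For $h:[0,T]\to\mathbb R$ and $[a,b]\subset[0,T]$ write $\|h\|_{p\text{-var};[a,b]}=\sup\big(\sum_i|h(t_{i+1})-h(t_i)|^p\big)^{1/p}$, the supremum being over all dissections $(t_i)$ of $[a,b]$. For $F:[0,T]^2\to\mathbb R$ write $F_{s,t}^{u,v}=F(t,v)-F(t,u)-F(s,v)+F(s,u)$ and $\|F\|_{p\text{-var};[a,b]\times[c,d]}=\sup\big(\sum_{i,j}|F_{t_i,t_{i+1}}^{t'_j,t'_{j+1}}|^p\big)^{1/p}$, the supremum being over all dissections $(t_i)$ of $[a,b]$ and $(t'_j)$ of $[c,d]$ (2D $p$-variation). Let $f,g,R:[0,T]^2\to\mathbb R$ be continuous. Assume that $f$ and $g$ have finite 2D $p$-variation on $[0,T]^2$, that for all $s,t\in[0,T]$ the functions $f(s,\cdot)$, $f(\cdot,t)$, $g(s,\cdot)$ and $g(\cdot,t)$ have finite $p$-variation on $[0,T]$, and that $R$ has finite 2D $q$-variation on $[0,T]^2$.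 Let $0\le a_j<b_j\le T$ for $j=1,2,3,4$. Then the four-dimensional Young integral $$I=\int_{[a_1,b_1]\times[a_2,b_2]\times[a_3,b_3]\times[a_4,b_4]} f(s_1,s_3)\,g(s_2,s_4)\,dR(s_1,s_2)\,dR(s_3,s_4)$$ exists, as the limit of the Riemann–Stieltjes sums $$\sum_{i,j,k,l} f(\xi^1_i,\xi^3_k)\,g(\xi^2_j,\xi^4_l)\,R_{t^1_i,t^1_{i+1}}^{t^2_j,t^2_{j+1}}\,R_{t^3_k,t^3_{k+1}}^{t^4_l,t^4_{l+1}},\qquad \xi^m_i\in[t^m_i,t^m_{i+1}],$$ over dissections $(t^m_i)_i$ of $[a_m,b_m]$, $m=1,\dots,4$, as the largest of the four meshes tends to $0$, uniformly over the choice of the tags $\xi^m_i$. Moreover $$|I|\le C_{p,q}\,\|R\|_{q\text{-var};[a_1,b_1]\times[a_2,b_2]}\,\|R\|_{q\text{-var};[a_3,b_3]\times[a_4,b_4]}\,N_f\,N_g,$$ where $$N_f=|f(a_1,a_3)|+\|f(\cdot,a_3)\|_{p\text{-var};[a_1,b_1]}+\|f(a_1,\cdot)\|_{p\text{-var};[a_3,b_3]}+\|f\|_{p\text{-var};[a_1,b_1]\times[a_3,b_3]},$$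 $$N_g=|g(a_2,a_4)|+\|g(\cdot,a_4)\|_{p\text{-var};[a_2,b_2]}+\|g(a_2,\cdot)\|_{p\text{-var};[a_4,b_4]}+\|g\|_{p\text{-var};[a_2,b_2]\times[a_4,b_4]}.$$ -/

import Mathlib

open scoped ENNReal NNReal

noncomputable section

namespace Young4D

/-- A dissection `a = t₀ ≤ t₁ ≤ ⋯ ≤ tₙ = b` of `[a, b]`. Only the points `pt 0, …, pt n` matter.
Repeated points are allowed: the corresponding cells carry zero increments, so neither the
variations nor the Riemann sums below are affected by them. -/
structure Dissection (a b : ℝ) where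
  /-- number of cells -/
  n : ℕ
  /-- the points of the dissection -/
  pt : ℕ → ℝ
  mono : Monotone pt
  pt_zero : pt 0 = a
  pt_last : pt n = b

/-- A dissection together with a tag in each of its cells `[tᵢ, tᵢ₊₁]`. -/
structure TaggedDissection (a b : ℝ) extends Dissection a b where
  /-- the tags -/
  tag : ℕ → ℝ
  tag_mem : ∀ i < n, tag i ∈ Set.Icc (pt i) (pt (i + 1))

/-- The mesh `maxᵢ (tᵢ₊₁ - tᵢ)` is smaller than `δ`. -/
def Dissection.MeshLT {a b : ℝ} (π : Dissection a b) (δ : ℝ) : Prop :=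
  ∀ i < π.n, π.pt (i + 1) - π.pt i < δ

/-- The one-dimensional `p`-variation `‖h‖_{p-var; [a, b]}`, with values in `[0, ∞]`. -/
def pVar (p : ℝ) (h : ℝ → ℝ) (a b : ℝ) : ℝ≥0∞ :=
  ⨆ π : Dissection a b,
    (∑ i ∈ Finset.range π.n, ‖h (π.pt (i + 1)) - h (π.pt i)‖ₑ ^ p) ^ (1 / p)

/-- The rectangular increment of `R` over `[s, t] × [u, v]`. -/
def rectIncr (R : ℝ → ℝ → ℝ) (s t u v : ℝ) : ℝ :=
  R t v - R t u - R s v + R s u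

/-- The 2D `p`-variation `‖R‖_{p-var; [a, b] × [c, d]}` (supremum over grids),
with values in `[0, ∞]`. -/
def pVar2 (p : ℝ) (R : ℝ → ℝ → ℝ) (a b c d : ℝ) : ℝ≥0∞ :=
  ⨆ (π : Dissection a b) (ρ : Dissection c d),
    (∑ i ∈ Finset.range π.n, ∑ j ∈ Finset.range ρ.n,
      ‖rectIncr R (π.pt i) (π.pt (i + 1)) (ρ.pt j) (ρ.pt (j + 1))‖ₑ ^ p) ^ (1 / p)

/-- The quantity
`|f(a,c)| + ‖f(·,c)‖_{p-var;[a,b]} + ‖f(a,·)‖_{p-var;[c,d]} + ‖f‖_{p-var;[a,b]×[c,d]}`. -/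
def fullVar2 (p : ℝ) (f : ℝ → ℝ → ℝ) (a b c d : ℝ) : ℝ≥0∞ :=
  ‖f a c‖ₑ + pVar p (fun s => f s c) a b + pVar p (fun t => f a t) c d + pVar2 p f a b c d

/-- `f` has finite 2D `p`-variation on `[0, T]²`, and all the functions `f(s, ·)` and `f(·, t)`
with `s, t ∈ [0, T]` have finite `p`-variation on `[0, T]`. -/
def FiniteVar2 (p : ℝ) (f : ℝ → ℝ → ℝ) (T : ℝ) : Prop :=
  pVar2 p f 0 T 0 T < ∞ ∧
    (∀ s ∈ Set.Icc 0 T, pVar p (fun t => f s t) 0 T < ∞) ∧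
    (∀ t ∈ Set.Icc 0 T, pVar p (fun s => f s t) 0 T < ∞)

/-- The Riemann–Stieltjes sum of `φ(s₁, s₂, s₃, s₄)` against `dR(s₁, s₂) dR(s₃, s₄)` along the
grid given by four tagged dissections. -/
def riemannSum4 (φ : ℝ → ℝ → ℝ → ℝ → ℝ) (R : ℝ → ℝ → ℝ) {a₁ b₁ a₂ b₂ a₃ b₃ a₄ b₄ : ℝ}
    (π₁ : TaggedDissection a₁ b₁) (π₂ : TaggedDissection a₂ b₂)
    (π₃ : TaggedDissection a₃ b₃) (π₄ : TaggedDissection a₄ b₄) : ℝ :=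
  ∑ i ∈ Finset.range π₁.n, ∑ j ∈ Finset.range π₂.n,
    ∑ k ∈ Finset.range π₃.n, ∑ l ∈ Finset.range π₄.n,
      φ (π₁.tag i) (π₂.tag j) (π₃.tag k) (π₄.tag l) *
        rectIncr R (π₁.pt i) (π₁.pt (i + 1)) (π₂.pt j) (π₂.pt (j + 1)) *
        rectIncr R (π₃.pt k) (π₃.pt (k + 1)) (π₄.pt l) (π₄.pt (l + 1))

/-- `I` is the Young integral of `φ(s₁, s₂, s₃, s₄)` against `dR(s₁, s₂) dR(s₃, s₄)` over
`[a₁, b₁] × [a₂, b₂] × [a₃, b₃] × [a₄, b₄]`: the limit of the Riemann–Stieltjes sums along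
tagged grids as the mesh tends to zero. -/
def IsYoungIntegral4 (φ : ℝ → ℝ → ℝ → ℝ → ℝ) (R : ℝ → ℝ → ℝ)
    (a₁ b₁ a₂ b₂ a₃ b₃ a₄ b₄ : ℝ) (I : ℝ) : Prop :=
  ∀ ε > 0, ∃ δ > 0,
    ∀ (π₁ : TaggedDissection a₁ b₁) (π₂ : TaggedDissection a₂ b₂)
      (π₃ : TaggedDissection a₃ b₃) (π₄ : TaggedDissection a₄ b₄),
      π₁.MeshLT δ → π₂.MeshLT δ → π₃.MeshLT δ → π₄.MeshLT δ →
        |riemannSum4 φ R π₁ π₂ π₃ π₄ - I| < ε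

end Young4D

end

/-! Everything rests on a discrete inequality whose constant does not depend on the grid. Young's
argument: in `∑ B(x(k+1), y(k+1) - y(k))`, merging two neighbouring cells costs one product `B(Δx,
Δy)`. By Hölder with `θ = 1/p + 1/q` and pigeonhole, among `n` cells some merge costs at most
`n^(-θ) K`, so removing all cells costs at most `ζ(θ) K`, finite because `θ > 1`. `young_merge`
proves this for every biadditive `B` and subadditive size `N`, so that it can be reused with vector
values.

The fourfold sum is contracted one variable at a time. Summing over `s₄` turns `g` and `R` into an
array `G(s₃, s₂)` of `q`-variation type in `s₃` and `p`-variation type in `s₂`; this is why mixed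
norms `ℓᵖ(ℓʳ)` are needed. Summing `f` against `G` over `s₃` leaves `Φ(s₂, s₁)` of finite 2D
`p`-variation (`MixedVarLE.contract`, twice). What remains is a 2D Young sum of `Φ` against `R`,
bounded by `young_towghi`.

For convergence, two Riemann sums are written on a common refinement, where only the tags differ.
Uniform continuity makes the change of `f` and `g` uniformly small, and interpolation with the
bounded `p`-variation makes it small in `p'`-variation, for some `p' > p` with `1/p' + 1/q > 1`
still. The discrete inequality with `p'` gives the Cauchy property; with `p` it gives the bound. -/

noncomputable section

namespace Young4D

/-! ### Young's merging argument -/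

/-- The increasing enumeration of `ℕ ∖ {i}`. -/
def skip (i j : ℕ) : ℕ := if j < i then j else j + 1

theorem skip_monotone (i : ℕ) : Monotone (skip i) := by
  intro a b h
  unfold skip
  split_ifs <;> omega

/-- The effect on a sum `∑ B(x(k+1), y(k+1) - y(k))` of merging two neighbouring cells. -/
theorem sum_eq_sum_skip_add {V W E : Type*} [AddCommGroup V] [AddCommGroup W] [AddCommGroup E]
    (B : V → W → E) (hB₁ : ∀ x x' y, B (x - x') y = B x y - B x' y)
    (hB₂ : ∀ x y y', B x (y - y') = B x y - B x y') (x : ℕ → V) (y : ℕ → W) (hx : x 0 = 0)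
    {i n : ℕ} (hi : i ≤ n) :
    ∑ k ∈ Finset.range (n + 1), B (x (k + 1)) (y (k + 1) - y k) =
      ∑ k ∈ Finset.range n, B (x (skip (i + 1) (k + 1))) (y (skip i (k + 1)) - y (skip i k)) +
        B (x (i + 1) - x i) (y (i + 1) - y i) := by
  induction n, hi using Nat.le_induction with
  | base =>
    rw [Finset.sum_range_succ]
    cases i with
    -- The first cell has no left neighbour and is simply dropped; since `x 0 = 0`, it equals the
    -- product of increments.
    | zero => simp [hx]
    | succ i =>
      rw [Finset.sum_range_succ, Finset.sum_range_succ]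
      have h : ∀ k ∈ Finset.range i,
          B (x (skip (i + 1 + 1) (k + 1))) (y (skip (i + 1) (k + 1)) - y (skip (i + 1) k)) =
            B (x (k + 1)) (y (k + 1) - y k) := by
        intro k hk
        have hk := Finset.mem_range.1 hk
        rw [skip, skip, skip, if_pos (by omega), if_pos (by omega), if_pos (by omega)]
      rw [Finset.sum_congr rfl h, skip, skip, skip, if_pos (by omega), if_neg (by omega),
        if_pos (by omega)]
      simp only [hB₁, hB₂]
      abel
  | succ n hn ih =>
    rw [Finset.sum_range_succ, ih, Finset.sum_range_succ (n := n)]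
    rw [skip, skip, skip, if_neg (show ¬ n + 1 < i + 1 by omega),
      if_neg (show ¬ n + 1 < i by omega), if_neg (show ¬ n < i by omega)]
    abel

/-- The constant `ζ(θ)` of Young's inequality. -/
def youngConst (θ : ℝ) : ℝ≥0∞ := ∑' m : ℕ, ((m : ℝ≥0∞) + 1) ^ (-θ)

theorem youngConst_lt_top {θ : ℝ} (hθ : 1 < θ) : youngConst θ < ∞ := by
  have h : Summable fun m : ℕ => ((m : ℝ) + 1) ^ (-θ) := by
    have := (summable_nat_add_iff 1).2 (Real.summable_nat_rpow.2 (show -θ < -1 by linarith))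
    simpa using this
  have h₂ : youngConst θ = ∑' m : ℕ, ENNReal.ofReal (((m : ℝ) + 1) ^ (-θ)) := by
    unfold youngConst
    congr 1
    ext m
    rw [← ENNReal.ofReal_rpow_of_pos (by positivity), ENNReal.ofReal_add (by positivity) (by simp)]
    simp
  rw [h₂]
  exact h.tsum_ofReal_lt_top

/-- Pigeonhole: the smallest of the `n + 1` terms is at most their average. -/
theorem exists_le_of_sum_le {n : ℕ} {θ : ℝ} (hθ : 0 < θ) (e : ℕ → ℝ≥0∞) (K : ℝ≥0∞)
    (h : ∑ k ∈ Finset.range (n + 1), e k ^ (1 / θ) ≤ K ^ (1 / θ)) :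
    ∃ i ≤ n, e i ≤ ((n : ℝ≥0∞) + 1) ^ (-θ) * K := by
  obtain ⟨i, hi, hmin⟩ := Finset.exists_min_image (Finset.range (n + 1))
    (fun k => e k ^ (1 / θ)) ⟨0, by simp⟩
  refine ⟨i, by simpa [Nat.lt_succ_iff] using hi, ?_⟩
  have h₁ := (Finset.card_nsmul_le_sum _ _ _ hmin).trans h
  rw [Finset.card_range, nsmul_eq_mul] at h₁
  have h₂ := ENNReal.rpow_le_rpow h₁ hθ.le
  rw [ENNReal.mul_rpow_of_nonneg _ _ hθ.le, ← ENNReal.rpow_mul, ← ENNReal.rpow_mul,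
    one_div_mul_cancel hθ.ne', ENNReal.rpow_one, ENNReal.rpow_one] at h₂
  have hn : ((n + 1 : ℕ) : ℝ≥0∞) = (n : ℝ≥0∞) + 1 := by push_cast; rfl
  rw [hn] at h₂
  rw [ENNReal.rpow_neg, mul_comm, ← div_eq_mul_inv]
  rw [ENNReal.le_div_iff_mul_le, mul_comm]
  · exact h₂
  · left
    simp [ENNReal.rpow_eq_zero_iff]
  · left
    exact ENNReal.rpow_ne_top_of_nonneg hθ.le (by simp)

/-- **Young's maximal inequality**, in an abstract form: the sum `∑ B(x(k+1), y(k+1) - y(k))` is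
controlled by the products of the increments of `x` and `y`. -/
theorem young_merge {V W E : Type*} [AddCommGroup V] [AddCommGroup W] [AddCommGroup E]
    (B : V → W → E) (hB₁ : ∀ x x' y, B (x - x') y = B x y - B x' y)
    (hB₂ : ∀ x y y', B x (y - y') = B x y - B x y')
    (N : E → ℝ≥0∞) (hN₀ : N 0 = 0) (hN : ∀ u v, N (u + v) ≤ N u + N v)
    {θ : ℝ} (hθ : 0 < θ) (K : ℝ≥0∞) (n : ℕ) (x : ℕ → V) (y : ℕ → W) (hx : x 0 = 0)
    (h : ∀ σ τ : ℕ → ℕ, Monotone σ → Monotone τ → ∀ m,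
      ∑ k ∈ Finset.range m,
        N (B (x (σ (k + 1)) - x (σ k)) (y (τ (k + 1)) - y (τ k))) ^ (1 / θ) ≤ K ^ (1 / θ)) :
    N (∑ k ∈ Finset.range n, B (x (k + 1)) (y (k + 1) - y k)) ≤ youngConst θ * K := by
  suffices H : N (∑ k ∈ Finset.range n, B (x (k + 1)) (y (k + 1) - y k)) ≤
      (∑ m ∈ Finset.range n, ((m : ℝ≥0∞) + 1) ^ (-θ)) * K by
    refine H.trans ?_
    gcongr
    exact ENNReal.sum_le_tsum _
  induction n generalizing x y with
  | zero => simp [hN₀]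
  | succ n ih =>
    -- Remove the cheapest cell. The merge deletes index `i + 1` from `x` but `i` from `y`, so the
    -- hypothesis must allow independent subsequences `σ`, `τ` to survive the induction.
    obtain ⟨i, hi, hie⟩ := exists_le_of_sum_le hθ _ K (h id id monotone_id monotone_id (n + 1))
    rw [sum_eq_sum_skip_add B hB₁ hB₂ x y hx hi, Finset.sum_range_succ, add_mul]
    refine (hN _ _).trans (add_le_add ?_ hie)
    refine ih (x ∘ skip (i + 1)) (y ∘ skip i) ?_ ?_
    · simpa [skip] using hx
    · intro σ τ hσ hτ m
      exact h (skip (i + 1) ∘ σ) (skip i ∘ τ) ((skip_monotone _).comp hσ)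
        ((skip_monotone _).comp hτ) m

/-- Hölder's inequality with exponents whose inverses add up to `θ`. -/
theorem sum_mul_rpow_le {ι : Type*} (s : Finset ι) {p q θ : ℝ} (hp : 0 < p) (hq : 0 < q)
    (hθ : 1 / p + 1 / q = θ) (a b : ι → ℝ≥0∞) {A B : ℝ≥0∞} (ha : ∑ i ∈ s, a i ^ p ≤ A ^ p)
    (hb : ∑ i ∈ s, b i ^ q ≤ B ^ q) :
    ∑ i ∈ s, (a i * b i) ^ (1 / θ) ≤ (A * B) ^ (1 / θ) := by
  have hθ₀ : 0 < θ := by rw [← hθ]; positivity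
  have hθ' : 0 ≤ 1 / θ := by positivity
  -- Hölder is applied to `a ^ (1/θ)` and `b ^ (1/θ)`.
  have hconj : (p * θ).HolderConjugate (q * θ) :=
    { inv_add_inv_eq_inv := by
        rw [mul_inv, mul_inv, ← add_mul, ← one_div p, ← one_div q, hθ, mul_inv_cancel₀ hθ₀.ne',
          inv_one]
      left_pos := by positivity
      right_pos := by positivity }
  have key := ENNReal.inner_le_Lp_mul_Lq s (fun i => a i ^ (1 / θ)) (fun i => b i ^ (1 / θ)) hconj
  have e₁ : 1 / θ * (p * θ) = p := by field_simp
  have e₂ : 1 / θ * (q * θ) = q := by field_simp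
  have e₃ : p * (1 / (p * θ)) = 1 / θ := by field_simp
  have e₄ : q * (1 / (q * θ)) = 1 / θ := by field_simp
  simp only [← ENNReal.rpow_mul, e₁, e₂] at key
  simp only [ENNReal.mul_rpow_of_nonneg _ _ hθ']
  refine key.trans ?_
  refine (mul_le_mul' (ENNReal.rpow_le_rpow ha (by positivity))
    (ENNReal.rpow_le_rpow hb (by positivity))).trans ?_
  rw [← ENNReal.rpow_mul, ← ENNReal.rpow_mul, e₃, e₄]

theorem sum_rpow_le_rpow_sum {ι : Type*} (s : Finset ι) {t : ℝ} (ht : 1 ≤ t) (a : ι → ℝ≥0∞) :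
    ∑ i ∈ s, a i ^ t ≤ (∑ i ∈ s, a i) ^ t := by
  classical
  induction s using Finset.induction_on with
  | empty => simp
  | insert i s hi ih =>
    rw [Finset.sum_insert hi, Finset.sum_insert hi]
    exact (add_le_add le_rfl ih).trans (ENNReal.add_rpow_le_rpow_add _ _ ht)

/-! ### Mixed norms and discrete variations -/

/-- The `ℓᵖ` norm of the first `n` terms of a sequence. -/
def lpSum (p : ℝ) (n : ℕ) (a : ℕ → ℝ≥0∞) : ℝ≥0∞ :=
  (∑ i ∈ Finset.range n, a i ^ p) ^ (1 / p)

theorem lpSum_rpow {p : ℝ} (hp : 0 < p) (n : ℕ) (a : ℕ → ℝ≥0∞) :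
    lpSum p n a ^ p = ∑ i ∈ Finset.range n, a i ^ p := by
  rw [lpSum, ← ENNReal.rpow_mul, one_div_mul_cancel hp.ne', ENNReal.rpow_one]

theorem lpSum_le_iff {p : ℝ} (hp : 0 < p) {n : ℕ} {a : ℕ → ℝ≥0∞} {K : ℝ≥0∞} :
    lpSum p n a ≤ K ↔ ∑ i ∈ Finset.range n, a i ^ p ≤ K ^ p := by
  rw [← lpSum_rpow hp, ENNReal.rpow_le_rpow_iff hp]

theorem lpSum_mono {p : ℝ} (hp : 0 < p) {n : ℕ} {a b : ℕ → ℝ≥0∞} (h : ∀ i, a i ≤ b i) :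
    lpSum p n a ≤ lpSum p n b := by
  rw [lpSum_le_iff hp, lpSum_rpow hp]
  exact Finset.sum_le_sum fun i _ => ENNReal.rpow_le_rpow (h i) hp.le

theorem lpSum_add_le {p : ℝ} (hp : 1 ≤ p) (n : ℕ) (a b : ℕ → ℝ≥0∞) :
    lpSum p n (fun i => a i + b i) ≤ lpSum p n a + lpSum p n b :=
  ENNReal.Lp_add_le _ _ _ hp

theorem lpSum_const_mul {p : ℝ} (hp : 0 < p) (n : ℕ) (c : ℝ≥0∞) (a : ℕ → ℝ≥0∞) :
    lpSum p n (fun i => c * a i) = c * lpSum p n a := by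
  simp only [lpSum, ENNReal.mul_rpow_of_nonneg _ _ hp.le, ← Finset.mul_sum]
  rw [ENNReal.mul_rpow_of_nonneg _ _ (by positivity), ← ENNReal.rpow_mul,
    mul_one_div_cancel hp.ne', ENNReal.rpow_one]

theorem lpSum_mul_const {p : ℝ} (hp : 0 < p) (n : ℕ) (c : ℝ≥0∞) (a : ℕ → ℝ≥0∞) :
    lpSum p n (fun i => a i * c) = lpSum p n a * c := by
  simp only [mul_comm _ c, lpSum_const_mul hp]

@[simp]
theorem lpSum_zero {p : ℝ} (hp : 0 < p) (n : ℕ) : lpSum p n (fun _ => 0) = 0 := by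
  simp [lpSum, hp]

/-- The mixed norm `ℓᵖ(ℓʳ)` of the leading `m × n` block of an array. -/
def mixedNorm (p r : ℝ) (m n : ℕ) (u : ℕ → ℕ → ℝ) : ℝ≥0∞ :=
  lpSum p m fun i => lpSum r n fun j => ‖u i j‖ₑ

theorem mixedNorm_zero {p r : ℝ} (hp : 0 < p) (hr : 0 < r) (m n : ℕ) :
    mixedNorm p r m n 0 = 0 := by
  simp [mixedNorm, hp, hr]

theorem mixedNorm_add_le {p r : ℝ} (hp : 1 ≤ p) (hr : 1 ≤ r) (m n : ℕ) (u v : ℕ → ℕ → ℝ) :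
    mixedNorm p r m n (u + v) ≤ mixedNorm p r m n u + mixedNorm p r m n v := by
  unfold mixedNorm
  refine (lpSum_mono (by linarith) fun i => ?_).trans (lpSum_add_le hp _ _ _)
  refine (lpSum_mono (by linarith) fun j => ?_).trans (lpSum_add_le hr _ _ _)
  exact enorm_add_le _ _

/-- The norm factorizes on rank-one arrays, which reduces vector-valued merge costs to the scalar
Hölder inequality. -/
theorem mixedNorm_tensor {p r : ℝ} (hp : 0 < p) (hr : 0 < r) (m n : ℕ) (x y : ℕ → ℝ) :
    mixedNorm p r m n (fun k j => x j * y k) =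
      lpSum r n (fun j => ‖x j‖ₑ) * lpSum p m (fun k => ‖y k‖ₑ) := by
  simp only [mixedNorm, enorm_mul, lpSum_mul_const hr, lpSum_const_mul hp]

/-- The increments of a double sequence along two sequences of indices. -/
def boxDiff (A : ℕ → ℕ → ℝ) (σ τ : ℕ → ℕ) (i j : ℕ) : ℝ :=
  A (σ (i + 1)) (τ (j + 1)) - A (σ (i + 1)) (τ j) - A (σ i) (τ (j + 1)) + A (σ i) (τ j)

/-- All grid increments of the double sequence `A` have `ℓᵖ(ℓʳ)` norm at most `K`. -/
def MixedVarLE (p r : ℝ) (A : ℕ → ℕ → ℝ) (K : ℝ≥0∞) : Prop :=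
  ∀ σ τ : ℕ → ℕ, Monotone σ → Monotone τ → ∀ m n, mixedNorm p r m n (boxDiff A σ τ) ≤ K

theorem MixedVarLE.swap {p : ℝ} (hp : 0 < p) {A : ℕ → ℕ → ℝ} {K : ℝ≥0∞}
    (h : MixedVarLE p p A K) : MixedVarLE p p (fun i j => A j i) K := by
  intro σ τ hσ hτ m n
  refine le_trans (le_of_eq ?_) (h τ σ hτ hσ n m)
  unfold mixedNorm
  rw [lpSum, lpSum]
  simp only [lpSum_rpow hp]
  rw [Finset.sum_comm]
  refine congrArg (· ^ (1 / p)) (Finset.sum_congr rfl fun j _ => Finset.sum_congr rfl fun i _ => ?_)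
  congr 2
  simp only [boxDiff]
  ring

/-! ### Contraction and the discrete inequalities in two and four dimensions -/

/-- Contracting two double sequences of finite mixed variation along one index, in the sense of
Young's inequality with values in `ℓˢ(ℓʳ)`. -/
theorem MixedVarLE.contract {p q r s θ : ℝ} (hp : 0 < p) (hq : 0 < q) (hr : 1 ≤ r) (hs : 1 ≤ s)
    (hθ : 1 / p + 1 / q = θ) {X Y : ℕ → ℕ → ℝ} {K L : ℝ≥0∞} (hX : MixedVarLE p r X K)
    (hY : MixedVarLE q s Y L) (hX₀ : ∀ j, X 0 j = 0) (n : ℕ) :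
    MixedVarLE s r
      (fun k j => ∑ l ∈ Finset.range n, X (l + 1) j * (Y (l + 1) k - Y l k))
      (youngConst θ * (K * L)) := by
  intro σ τ hσ hτ m m'
  have hθ₀ : 0 < θ := by rw [← hθ]; positivity
  -- A box increment of the contracted array is again a Young sum in `l`, of the `τ`-increments of
  -- `X` against the `σ`-increments of `Y`.
  have key := young_merge (V := ℕ → ℝ) (W := ℕ → ℝ) (E := ℕ → ℕ → ℝ)
    (fun x y k j => x j * y k) (fun x x' y => by ext; simp [sub_mul])
    (fun x y y' => by ext; simp [mul_sub]) (mixedNorm s r m m')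
    (mixedNorm_zero (by linarith) (by linarith) _ _) (mixedNorm_add_le hs hr _ _) hθ₀ (K * L) n
    (fun l j => X l (τ (j + 1)) - X l (τ j)) (fun l k => Y l (σ (k + 1)) - Y l (σ k))
    (by ext; simp [hX₀]) ?_
  · convert key using 2
    ext k j
    simp only [boxDiff, Finset.sum_apply, Pi.sub_apply]
    rw [← Finset.sum_sub_distrib, ← Finset.sum_sub_distrib, ← Finset.sum_add_distrib]
    exact Finset.sum_congr rfl fun l _ => by ring
  · intro α β hα hβ M
    simp only [mixedNorm_tensor (show 0 < s by linarith) (show 0 < r by linarith)]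
    refine sum_mul_rpow_le _ hp hq hθ _ _ ?_ ?_
    · have := (lpSum_le_iff hp).1 (hX α τ hα hτ M m')
      convert this using 6
      simp only [boxDiff, Pi.sub_apply]; ring_nf
    · have := (lpSum_le_iff hq).1 (hY β σ hβ hσ M m)
      convert this using 6
      simp only [boxDiff, Pi.sub_apply]; ring_nf

theorem sum_enorm_rpow_add_le {r : ℝ} (hr : 0 < r) (hr₁ : r ≤ 1) (m : ℕ) (u v : ℕ → ℝ) :
    ∑ i ∈ Finset.range m, ‖(u + v) i‖ₑ ^ r ≤
      ∑ i ∈ Finset.range m, ‖u i‖ₑ ^ r + ∑ i ∈ Finset.range m, ‖v i‖ₑ ^ r := by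
  rw [← Finset.sum_add_distrib]
  refine Finset.sum_le_sum fun i _ => ?_
  exact (ENNReal.rpow_le_rpow (enorm_add_le _ _) hr.le).trans
    (ENNReal.rpow_add_le_add_rpow _ _ hr.le hr₁)

/-- The constant in the two-dimensional Young inequality. -/
def youngConst₂ (r θ : ℝ) : ℝ≥0∞ := youngConst (1 / r) * youngConst (r * θ) ^ (1 / r)

/-- **The Young–Towghi maximal inequality** for double sequences. -/
theorem young_towghi {p q r θ : ℝ} (hp : 0 < p) (hq : 0 < q) (hr : 0 < r) (hr₁ : r ≤ 1)
    (hθ : 1 / p + 1 / q = θ) (hrθ : 1 ≤ r * θ) {X Y : ℕ → ℕ → ℝ} {K L : ℝ≥0∞}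
    (hX : MixedVarLE p p X K) (hY : MixedVarLE q q Y L) (hX₀ : ∀ i, X 0 i = 0)
    (hX₀' : ∀ i, X i 0 = 0) (m n : ℕ) :
    ‖∑ j ∈ Finset.range m, ∑ i ∈ Finset.range n,
      X (j + 1) (i + 1) * (Y (j + 1) (i + 1) - Y (j + 1) i - Y j (i + 1) + Y j i)‖ₑ ≤
      youngConst₂ r θ * (K * L) := by
  have hθ₀ : 0 < θ := by rw [← hθ]; positivity
  -- Merge in `i` for a whole vector of `j`-increments at once. Its size is `∑ |u j| ^ r`,
  -- subadditive since `r ≤ 1`; the result is the cost bound for merging in `j`.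
  have inner : ∀ σ τ : ℕ → ℕ, Monotone σ → Monotone τ → ∀ M,
      ∑ j ∈ Finset.range M, ‖∑ i ∈ Finset.range n,
        (X (σ (j + 1)) (i + 1) - X (σ j) (i + 1)) *
          ((Y (τ (j + 1)) (i + 1) - Y (τ j) (i + 1)) - (Y (τ (j + 1)) i - Y (τ j) i))‖ₑ ^ r ≤
        youngConst (r * θ) * (K * L) ^ r := by
    intro σ τ hσ hτ M
    have key := young_merge (V := ℕ → ℝ) (W := ℕ → ℝ) (E := ℕ → ℝ)
      (fun x y j => x j * y j) (fun x x' y => by ext; simp [sub_mul])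
      (fun x y y' => by ext; simp [mul_sub]) (fun u => ∑ j ∈ Finset.range M, ‖u j‖ₑ ^ r)
      (by simp [hr]) (sum_enorm_rpow_add_le hr hr₁ M) (by positivity : 0 < r * θ) ((K * L) ^ r) n
      (fun i j => X (σ (j + 1)) i - X (σ j) i) (fun i j => Y (τ (j + 1)) i - Y (τ j) i)
      (by ext; simp [hX₀']) ?_
    · simpa only [Finset.sum_apply, Pi.sub_apply] using key
    · intro α β hα hβ M'
      have e : r * (1 / (r * θ)) = 1 / θ := by field_simp
      have e' : 1 / θ * (r * θ) = r := by field_simp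
      rw [← ENNReal.rpow_mul, e]
      have h₁ := (hX σ α hσ hα M M')
      have h₂ := (hY τ β hτ hβ M M')
      unfold mixedNorm at h₁ h₂
      rw [lpSum_le_iff hp] at h₁
      rw [lpSum_le_iff hq] at h₂
      simp only [lpSum_rpow hp] at h₁
      simp only [lpSum_rpow hq] at h₂
      rw [Finset.sum_comm, ← Finset.sum_product'] at h₁ h₂
      refine le_trans ?_ (sum_mul_rpow_le _ hp hq hθ _ _ h₁ h₂)
      rw [Finset.sum_product]
      refine Finset.sum_le_sum fun i _ => ?_
      -- As `rθ ≥ 1`, the `ℓʳ` size is dominated by the `ℓ^(1/θ)` size, to which Hölder applies.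
      have h₃ := sum_rpow_le_rpow_sum (Finset.range M) hrθ
        (fun j => (‖boxDiff X σ α j i‖ₑ * ‖boxDiff Y τ β j i‖ₑ) ^ (1 / θ))
      simp only [← ENNReal.rpow_mul, e'] at h₃
      have h₄ := ENNReal.rpow_le_rpow h₃ (show 0 ≤ 1 / (r * θ) by positivity)
      rw [← ENNReal.rpow_mul, mul_one_div_cancel (by positivity), ENNReal.rpow_one] at h₄
      refine le_trans (le_of_eq ?_) h₄
      congr 1
      refine Finset.sum_congr rfl fun j _ => ?_
      rw [← enorm_mul]
      congr 3
      simp only [boxDiff, Pi.sub_apply]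
      ring
  have key := young_merge (V := ℕ → ℝ) (W := ℕ → ℝ) (E := ℝ)
      (fun x y => ∑ i ∈ Finset.range n, x (i + 1) * (y (i + 1) - y i))
      (fun x x' y => by simp [sub_mul, Finset.sum_sub_distrib])
      (fun x y y' => by
        rw [← Finset.sum_sub_distrib]
        exact Finset.sum_congr rfl fun i _ => by simp only [Pi.sub_apply]; ring)
      (fun u => ‖u‖ₑ) (by simp) enorm_add_le (by positivity : 0 < 1 / r)
      ((youngConst (r * θ) * (K * L) ^ r) ^ (1 / r)) m X Y (by ext; simp [hX₀]) ?_
  · rw [ENNReal.mul_rpow_of_nonneg _ _ (by positivity), ← ENNReal.rpow_mul,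
      mul_one_div_cancel hr.ne', ENNReal.rpow_one, ← mul_assoc] at key
    refine le_trans (le_of_eq ?_) key
    congr 1
    refine Finset.sum_congr rfl fun j _ => Finset.sum_congr rfl fun i _ => ?_
    simp only [Pi.sub_apply]
    ring
  · intro σ τ hσ hτ M
    simp only [one_div_one_div]
    rw [← ENNReal.rpow_mul, one_div_mul_cancel hr.ne', ENNReal.rpow_one]
    exact inner σ τ hσ hτ M

/-- The constant in the four-dimensional Young inequality with exponents `p` and `q`. -/
def youngConst₄ (p q : ℝ) : ℝ≥0∞ :=
  youngConst₂ ((1 + 1 / (1 / p + 1 / q)) / 2) (1 / p + 1 / q) *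
    (youngConst (1 / p + 1 / q) * youngConst (1 / p + 1 / q))

theorem youngConst₄_lt_top {p q : ℝ} (hpq : 1 < 1 / p + 1 / q) : youngConst₄ p q < ∞ := by
  unfold youngConst₄ youngConst₂
  set θ := 1 / p + 1 / q with hθ
  have h₁ : 1 / θ < 1 := by rw [div_lt_one] <;> linarith
  have h₀ : 0 < 1 / θ := by positivity
  -- The exponent `r` is the midpoint of `1/θ` and `1`, so both `1/r` and `rθ` exceed `1` and both
  -- zeta sums converge.
  have h₂ : 1 < 1 / ((1 + 1 / θ) / 2) := by rw [one_lt_div] <;> linarith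
  have h₃ : 1 < (1 + 1 / θ) / 2 * θ := by
    have : (1 + 1 / θ) / 2 * θ = (θ + 1) / 2 := by field_simp
    linarith
  have := youngConst_lt_top hpq
  have := youngConst_lt_top h₂
  have := ENNReal.rpow_lt_top_of_nonneg (show 0 ≤ 1 / ((1 + 1 / θ) / 2) by positivity)
    (youngConst_lt_top h₃).ne
  exact ENNReal.mul_lt_top (ENNReal.mul_lt_top ‹_› ‹_›) (ENNReal.mul_lt_top ‹_› ‹_›)

/-- **The four-dimensional maximal inequality**: the discrete form of the bound for
`∫ f(s₁, s₃) g(s₂, s₄) dR(s₁, s₂) dS(s₃, s₄)`. -/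
theorem young_four {p q : ℝ} (hp : 1 ≤ p) (hq : 1 ≤ q) (hpq : 1 < 1 / p + 1 / q)
    {f g R S : ℕ → ℕ → ℝ} {K L M M' : ℝ≥0∞} (hf : MixedVarLE p p f K) (hg : MixedVarLE p p g L)
    (hR : MixedVarLE q q R M) (hS : MixedVarLE q q S M') (hf₀ : ∀ i, f 0 i = 0)
    (hf₀' : ∀ i, f i 0 = 0) (hg₀ : ∀ i, g 0 i = 0) (hg₀' : ∀ i, g i 0 = 0) (n₁ n₂ n₃ n₄ : ℕ) :
    ‖∑ i ∈ Finset.range n₁, ∑ j ∈ Finset.range n₂, ∑ k ∈ Finset.range n₃, ∑ l ∈ Finset.range n₄,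
      f (i + 1) (k + 1) * g (j + 1) (l + 1) * boxDiff R id id i j * boxDiff S id id k l‖ₑ ≤
      youngConst₄ p q * (K * L * M * M') := by
  set θ := 1 / p + 1 / q with hθ
  have h₁ : 1 / θ < 1 := by rw [div_lt_one] <;> linarith
  have h₀ : 0 < 1 / θ := by positivity
  have h₃ : 1 ≤ (1 + 1 / θ) / 2 * θ := by
    have : (1 + 1 / θ) / 2 * θ = (θ + 1) / 2 := by field_simp
    linarith
  have hp₀ : 0 < p := by linarith
  have hq₀ : 0 < q := by linarith
  -- `G(k, j)` has exponent `q` in `k` and `p` in `j`; contracting it with `f` over `k` leaves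
  -- exponent `p` in both indices.
  have hG := MixedVarLE.contract hp₀ hq₀ hp hq hθ.symm (hg.swap hp₀) (hS.swap hq₀)
    (fun j => hg₀' j) n₄
  have hΦ := MixedVarLE.contract hp₀ hq₀ hp hp hθ.symm (hf.swap hp₀) hG (fun j => hf₀' j) n₃
  have key := young_towghi hp₀ hq₀ (by positivity) (by linarith) hθ.symm h₃ hΦ (hR.swap hq₀)
    (by simp [hg₀]) (by simp [hf₀]) n₂ n₁
  refine le_trans (le_of_eq ?_) (key.trans (le_of_eq ?_))
  · congr 1
    rw [Finset.sum_comm]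
    refine Finset.sum_congr rfl fun j _ => Finset.sum_congr rfl fun i _ => ?_
    rw [Finset.sum_mul]
    refine Finset.sum_congr rfl fun k _ => ?_
    rw [← Finset.sum_sub_distrib, Finset.mul_sum, Finset.sum_mul]
    refine Finset.sum_congr rfl fun l _ => ?_
    simp only [boxDiff, id]
    ring
  · rw [youngConst₄]
    ring

/-! ### From real variations to discrete ones -/

/-- Adding the endpoints `a` and `b` shifts indices by one and only enlarges the variation sums. -/
theorem exists_dissection {a b : ℝ} {v : ℕ → ℝ} (hv : Monotone v) (m : ℕ)
    (hm : ∀ i ≤ m, v i ∈ Set.Icc a b) :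
    ∃ π : Dissection a b, π.n = m + 2 ∧ ∀ i ≤ m, π.pt (i + 1) = v i := by
  refine ⟨⟨m + 2, fun k => if k = 0 then a else if k ≤ m + 1 then v (k - 1) else b, ?_, by simp,
    by simp⟩, rfl, fun i hi => by simp [hi]⟩
  refine monotone_nat_of_le_succ fun k => ?_
  rcases Nat.eq_zero_or_pos k with rfl | hk
  · simpa using (hm 0 (by omega)).1
  · simp only [hk.ne', if_false, Nat.succ_ne_zero, Nat.add_sub_cancel]
    split_ifs with h₁ h₂
    · exact hv (by omega)
    · exact (hm _ (by omega)).2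
    · omega
    · exact le_rfl

theorem sum_range_succ_le {m : ℕ} (F : ℕ → ℝ≥0∞) :
    ∑ i ∈ Finset.range m, F (i + 1) ≤ ∑ i ∈ Finset.range (m + 2), F i := by
  rw [Finset.sum_range_succ, Finset.sum_range_succ', add_assoc]
  exact le_self_add

theorem lpSum_le_pVar {p : ℝ} (hp : 0 < p) {a b : ℝ} (h : ℝ → ℝ) {v : ℕ → ℝ}
    (hv : Monotone v) (m : ℕ) (hm : ∀ i ≤ m, v i ∈ Set.Icc a b) :
    lpSum p m (fun i => ‖h (v (i + 1)) - h (v i)‖ₑ) ≤ pVar p h a b := by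
  obtain ⟨π, hn, hπ⟩ := exists_dissection hv m hm
  refine le_trans ?_ (le_iSup _ π)
  refine ENNReal.rpow_le_rpow ?_ (by positivity)
  rw [hn]
  refine le_trans (le_of_eq ?_) (sum_range_succ_le _)
  refine Finset.sum_congr rfl fun i hi => ?_
  have := Finset.mem_range.1 hi
  rw [hπ i (by omega), hπ (i + 1) (by omega)]

theorem mixedNorm_le_pVar2 {p : ℝ} (hp : 0 < p) {a b c d : ℝ}
    (f : ℝ → ℝ → ℝ) {u v : ℕ → ℝ} (hu : Monotone u) (hv : Monotone v) (m n : ℕ)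
    (hm : ∀ i ≤ m, u i ∈ Set.Icc a b) (hn : ∀ i ≤ n, v i ∈ Set.Icc c d) :
    mixedNorm p p m n (fun i j => rectIncr f (u i) (u (i + 1)) (v j) (v (j + 1))) ≤
      pVar2 p f a b c d := by
  obtain ⟨π, hπn, hπ⟩ := exists_dissection hu m hm
  obtain ⟨ρ, hρn, hρ⟩ := exists_dissection hv n hn
  refine le_trans ?_ (le_iSup₂ π ρ)
  unfold mixedNorm
  rw [lpSum]
  simp only [lpSum_rpow hp]
  refine ENNReal.rpow_le_rpow ?_ (by positivity)
  rw [hπn, hρn]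
  refine le_trans ?_ (sum_range_succ_le _)
  refine Finset.sum_le_sum fun i hi => ?_
  refine le_trans (le_of_eq ?_) (sum_range_succ_le _)
  refine Finset.sum_congr rfl fun j hj => ?_
  have := Finset.mem_range.1 hi
  have := Finset.mem_range.1 hj
  rw [hπ i (by omega), hπ (i + 1) (by omega), hρ j (by omega), hρ (j + 1) (by omega)]

theorem Dissection.pt_mem {a b : ℝ} (π : Dissection a b) {i : ℕ} (hi : i ≤ π.n) :
    π.pt i ∈ Set.Icc a b := by
  exact ⟨π.pt_zero.ge.trans (π.mono (Nat.zero_le i)), (π.mono hi).trans π.pt_last.le⟩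

theorem pVar_mono {p : ℝ} (hp : 0 < p) (h : ℝ → ℝ) {a b a' b' : ℝ} (ha : a' ≤ a)
    (hb : b ≤ b') : pVar p h a b ≤ pVar p h a' b' :=
  iSup_le fun π => lpSum_le_pVar hp h π.mono π.n fun _ hi =>
    Set.Icc_subset_Icc ha hb (π.pt_mem hi)

theorem pVar2_mono {p : ℝ} (hp : 0 < p) (f : ℝ → ℝ → ℝ) {a b a' b' c d c' d' : ℝ} (ha : a' ≤ a)
    (hb : b ≤ b') (hc : c' ≤ c) (hd : d ≤ d') :
    pVar2 p f a b c d ≤ pVar2 p f a' b' c' d' := by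
  refine iSup₂_le fun π ρ => ?_
  have := mixedNorm_le_pVar2 hp f π.mono ρ.mono
    π.n ρ.n (fun _ hi => Set.Icc_subset_Icc ha hb (π.pt_mem hi))
    (fun _ hi => Set.Icc_subset_Icc hc hd (ρ.pt_mem hi))
  unfold mixedNorm at this
  rw [lpSum] at this
  simpa only [lpSum_rpow hp] using this

theorem FiniteVar2.fullVar2_lt_top {p : ℝ} (hp : 0 < p) {f : ℝ → ℝ → ℝ} {T : ℝ}
    (hf : FiniteVar2 p f T) {a b c d : ℝ} (ha : 0 ≤ a) (hab : a ≤ b) (hb : b ≤ T) (hc : 0 ≤ c)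
    (hcd : c ≤ d) (hd : d ≤ T) : fullVar2 p f a b c d < ∞ := by
  unfold fullVar2
  refine ENNReal.add_lt_top.2
    ⟨ENNReal.add_lt_top.2 ⟨ENNReal.add_lt_top.2 ⟨enorm_lt_top, ?_⟩, ?_⟩, ?_⟩
  · exact (pVar_mono hp _ ha hb).trans_lt (hf.2.2 c ⟨hc, hcd.trans hd⟩)
  · exact (pVar_mono hp _ hc hd).trans_lt (hf.2.1 a ⟨ha, hab.trans hb⟩)
  · exact (pVar2_mono hp _ ha hb hc hd).trans_lt hf.1

/-! ### Extension by zero and the full variation -/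

/-- The values of `f` on a grid, extended by zero to an additional first row and column. -/
def gridExt (f : ℝ → ℝ → ℝ) (u v : ℕ → ℝ) : ℕ → ℕ → ℝ
  | 0, _ => 0
  | _ + 1, 0 => 0
  | i + 1, j + 1 => f (u i) (v j)

@[simp]
theorem gridExt_zero_left (f : ℝ → ℝ → ℝ) (u v : ℕ → ℝ) (j : ℕ) : gridExt f u v 0 j = 0 := rfl

@[simp]
theorem gridExt_zero_right (f : ℝ → ℝ → ℝ) (u v : ℕ → ℝ) (i : ℕ) : gridExt f u v i 0 = 0 := by
  cases i <;> rfl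

/-- The indicator of the positive natural numbers. -/
def posInd (i : ℕ) : ℝ := if i = 0 then 0 else 1

/-- The sequence `a, u 0, u 1, …`. -/
def consSeq (a : ℝ) (u : ℕ → ℝ) (i : ℕ) : ℝ := if i = 0 then a else u (i - 1)

theorem consSeq_monotone {a b : ℝ} {u : ℕ → ℝ} (hu : Monotone u) (h : ∀ i, u i ∈ Set.Icc a b) :
    Monotone (consSeq a u) := by
  refine monotone_nat_of_le_succ fun k => ?_
  rcases Nat.eq_zero_or_pos k with rfl | hk
  · simpa [consSeq] using (h 0).1
  · simpa [consSeq, hk.ne'] using hu (Nat.sub_le k 1)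

theorem consSeq_mem {a b : ℝ} (hab : a ≤ b) {u : ℕ → ℝ} (h : ∀ i, u i ∈ Set.Icc a b) (i : ℕ) :
    consSeq a u i ∈ Set.Icc a b := by
  unfold consSeq
  split_ifs
  · exact ⟨le_rfl, hab⟩
  · exact h _

theorem lpSum_posInd_le {p : ℝ} (hp : 0 < p) {σ : ℕ → ℕ} (hσ : Monotone σ) (m : ℕ) :
    lpSum p m (fun i => ‖posInd (σ (i + 1)) - posInd (σ i)‖ₑ) ≤ 1 := by
  rw [lpSum_le_iff hp, ENNReal.one_rpow]
  -- The indicator jumps at most once along `σ`; the induction records whether the jump has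
  -- occurred.
  suffices H : ∑ i ∈ Finset.range m, ‖posInd (σ (i + 1)) - posInd (σ i)‖ₑ ^ p ≤
      if σ m = 0 then 0 else 1 from H.trans (by split_ifs <;> simp)
  induction m with
  | zero => simp
  | succ m ih =>
    rw [Finset.sum_range_succ]
    have := hσ (Nat.le_succ m)
    by_cases h₁ : σ m = 0
    · rw [if_pos h₁] at ih
      rw [nonpos_iff_eq_zero.1 ih, zero_add]
      by_cases h₂ : σ (m + 1) = 0 <;> simp [posInd, h₁, h₂, hp]
    · have h₂ : σ (m + 1) ≠ 0 := by
        simp only [Nat.succ_eq_add_one] at this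
        omega
      rw [if_neg h₁] at ih
      simpa [posInd, h₁, h₂, hp] using ih

/-- The zero row and column supply the vanishing initial values that merging requires. The jumps off
them cost exactly the corner and edge terms of `fullVar2`, one for each summand in the decomposition
of `f` around `(a, c)`. -/
theorem mixedVarLE_gridExt {p : ℝ} (hp : 1 ≤ p) {a b c d : ℝ} (hab : a ≤ b) (hcd : c ≤ d)
    (f : ℝ → ℝ → ℝ) {u v : ℕ → ℝ} (hu : Monotone u) (hv : Monotone v)
    (hu' : ∀ i, u i ∈ Set.Icc a b) (hv' : ∀ i, v i ∈ Set.Icc c d) :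
    MixedVarLE p p (gridExt f u v) (fullVar2 p f a b c d) := by
  intro σ τ hσ hτ m n
  have hp₀ : 0 < p := by linarith
  set U := consSeq a u with hU
  set V := consSeq c v with hV
  have hUσ := (consSeq_monotone hu hu').comp hσ
  have hVτ := (consSeq_monotone hv hv').comp hτ
  have hUm : ∀ i ≤ m, (U ∘ σ) i ∈ Set.Icc a b := fun i _ => consSeq_mem hab hu' _
  have hVm : ∀ i ≤ n, (V ∘ τ) i ∈ Set.Icc c d := fun i _ => consSeq_mem hcd hv' _
  have hext : ∀ i j, gridExt f u v i j = f a c * posInd i * posInd j +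
      (f (U i) c - f a c) * posInd j + posInd i * (f a (V j) - f a c) +
      rectIncr f a (U i) c (V j) := by
    intro i j
    rcases i with _ | i <;> rcases j with _ | j <;>
      simp only [posInd, hU, hV, consSeq, rectIncr, gridExt, Nat.add_sub_cancel,
        Nat.add_one_ne_zero, if_true, if_false] <;> ring
  have hbox : boxDiff (gridExt f u v) σ τ =
      (fun i j => (posInd (τ (j + 1)) - posInd (τ j)) *
        (f a c * (posInd (σ (i + 1)) - posInd (σ i)))) +
      (fun i j => (posInd (τ (j + 1)) - posInd (τ j)) * (f (U (σ (i + 1))) c - f (U (σ i)) c)) +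
      (fun i j => (f a (V (τ (j + 1))) - f a (V (τ j))) * (posInd (σ (i + 1)) - posInd (σ i))) +
      (fun i j => rectIncr f (U (σ i)) (U (σ (i + 1))) (V (τ j)) (V (τ (j + 1)))) := by
    ext i j
    simp only [boxDiff, hext, Pi.add_apply, rectIncr]
    ring
  rw [hbox]
  refine (mixedNorm_add_le hp hp _ _ _ _).trans (add_le_add ((mixedNorm_add_le hp hp _ _ _ _).trans
    (add_le_add ((mixedNorm_add_le hp hp _ _ _ _).trans (add_le_add ?_ ?_)) ?_)) ?_)
  · rw [mixedNorm_tensor hp₀ hp₀]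
    simp only [enorm_mul]
    rw [lpSum_const_mul hp₀]
    calc _ ≤ 1 * (‖f a c‖ₑ * 1) := by
            gcongr
            · exact lpSum_posInd_le hp₀ hτ n
            · exact lpSum_posInd_le hp₀ hσ m
      _ = _ := by simp
  · rw [mixedNorm_tensor hp₀ hp₀]
    calc _ ≤ 1 * pVar p (fun s => f s c) a b := by
            gcongr
            · exact lpSum_posInd_le hp₀ hτ n
            · exact lpSum_le_pVar hp₀ (fun s => f s c) hUσ m hUm
      _ = _ := by simp
  · rw [mixedNorm_tensor hp₀ hp₀]
    calc _ ≤ pVar p (fun t => f a t) c d * 1 := by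
            gcongr
            · exact lpSum_le_pVar hp₀ (fun t => f a t) hVτ n hVm
            · exact lpSum_posInd_le hp₀ hσ m
      _ = _ := by simp
  · exact mixedNorm_le_pVar2 hp₀ f hUσ hVτ m n hUm hVm

theorem mixedVarLE_grid {q : ℝ} (hq : 0 < q) {a b c d : ℝ}
    (R : ℝ → ℝ → ℝ) {u v : ℕ → ℝ} (hu : Monotone u) (hv : Monotone v)
    (hu' : ∀ i, u i ∈ Set.Icc a b) (hv' : ∀ i, v i ∈ Set.Icc c d) :
    MixedVarLE q q (fun i j => R (u i) (v j)) (pVar2 q R a b c d) := fun _ _ hσ hτ m n =>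
  mixedNorm_le_pVar2 hq R (hu.comp hσ) (hv.comp hτ) m n (fun _ _ => hu' _) (fun _ _ => hv' _)

/-! ### Differences and interpolation -/

theorem MixedVarLE.sub {p : ℝ} (hp : 1 ≤ p) {A B : ℕ → ℕ → ℝ} {K L : ℝ≥0∞}
    (hA : MixedVarLE p p A K) (hB : MixedVarLE p p B L) : MixedVarLE p p (A - B) (K + L) := by
  intro σ τ hσ hτ m n
  have h : boxDiff (A - B) σ τ = boxDiff A σ τ + -boxDiff B σ τ := by
    ext i j
    simp only [boxDiff, Pi.sub_apply, Pi.add_apply, Pi.neg_apply]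
    ring
  rw [h]
  refine (mixedNorm_add_le hp hp _ _ _ _).trans (add_le_add (hA σ τ hσ hτ m n) ?_)
  simpa only [mixedNorm, Pi.neg_apply, enorm_neg] using hB σ τ hσ hτ m n

theorem mixedNorm_self_le_iff {p : ℝ} (hp : 0 < p) {m n : ℕ} {u : ℕ → ℕ → ℝ} {K : ℝ≥0∞} :
    mixedNorm p p m n u ≤ K ↔
      ∑ x ∈ Finset.range m ×ˢ Finset.range n, ‖u x.1 x.2‖ₑ ^ p ≤ K ^ p := by
  rw [mixedNorm, lpSum_le_iff hp, Finset.sum_product]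
  simp only [lpSum_rpow hp]

theorem MixedVarLE.of_exponent_le {p p' : ℝ} (hp : 0 < p) (hpp : p ≤ p') {A : ℕ → ℕ → ℝ}
    {K : ℝ≥0∞} (hA : MixedVarLE p p A K) : MixedVarLE p' p' A K := by
  intro σ τ hσ hτ m n
  have h := hA σ τ hσ hτ m n
  rw [mixedNorm_self_le_iff hp] at h
  rw [mixedNorm_self_le_iff (by linarith)]
  have key := sum_rpow_le_rpow_sum (Finset.range m ×ˢ Finset.range n) ((one_le_div hp).2 hpp)
    (fun x => ‖boxDiff A σ τ x.1 x.2‖ₑ ^ p)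
  simp only [← ENNReal.rpow_mul, mul_div_cancel₀ p' hp.ne'] at key
  refine key.trans ((ENNReal.rpow_le_rpow h (div_nonneg (by linarith) hp.le)).trans (le_of_eq ?_))
  rw [← ENNReal.rpow_mul, mul_div_cancel₀ p' hp.ne']

/-- Interpolation between the supremum of the increments and the `p`-variation. -/
theorem MixedVarLE.interpolate {p p' : ℝ} (hp : 0 < p) (hpp : p ≤ p') {A : ℕ → ℕ → ℝ}
    {K η : ℝ≥0∞} (hA : MixedVarLE p p A K) (hη : ∀ σ τ i j, ‖boxDiff A σ τ i j‖ₑ ≤ η) :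
    MixedVarLE p' p' A (η ^ ((p' - p) / p') * K ^ (p / p')) := by
  intro σ τ hσ hτ m n
  have hp' : 0 < p' := by linarith
  have h := hA σ τ hσ hτ m n
  rw [mixedNorm_self_le_iff hp] at h
  rw [mixedNorm_self_le_iff hp', ENNReal.mul_rpow_of_nonneg _ _ hp'.le, ← ENNReal.rpow_mul,
    ← ENNReal.rpow_mul, div_mul_cancel₀ _ hp'.ne', div_mul_cancel₀ _ hp'.ne']
  refine le_trans ?_ (mul_le_mul' le_rfl h)
  rw [Finset.mul_sum]
  refine Finset.sum_le_sum fun x _ => ?_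
  calc ‖boxDiff A σ τ x.1 x.2‖ₑ ^ p'
      = ‖boxDiff A σ τ x.1 x.2‖ₑ ^ (p' - p) * ‖boxDiff A σ τ x.1 x.2‖ₑ ^ p := by
        rw [← ENNReal.rpow_add_of_nonneg _ _ (by linarith) hp.le, sub_add_cancel]
    _ ≤ η ^ (p' - p) * ‖boxDiff A σ τ x.1 x.2‖ₑ ^ p := by
        exact mul_le_mul' (ENNReal.rpow_le_rpow (hη σ τ _ _) (by linarith)) le_rfl

theorem enorm_boxDiff_le {A : ℕ → ℕ → ℝ} {η : ℝ≥0∞} (hA : ∀ i j, ‖A i j‖ₑ ≤ η) (σ τ : ℕ → ℕ)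
    (i j : ℕ) : ‖boxDiff A σ τ i j‖ₑ ≤ 4 * η := by
  unfold boxDiff
  calc _ ≤ η + η + η + η :=
        (enorm_add_le _ _).trans (add_le_add ((enorm_sub_le).trans
          (add_le_add ((enorm_sub_le).trans (add_le_add (hA _ _) (hA _ _))) (hA _ _))) (hA _ _))
    _ = 4 * η := by ring

theorem enorm_gridExt_sub_le {f : ℝ → ℝ → ℝ} {u u' v v' : ℕ → ℝ} {η : ℝ≥0∞}
    (h : ∀ i j, ‖f (u i) (v j) - f (u' i) (v' j)‖ₑ ≤ η) (i j : ℕ) :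
    ‖(gridExt f u v - gridExt f u' v') i j‖ₑ ≤ η := by
  rcases i with _ | i <;> rcases j with _ | j
  · simp
  · simp
  · simp
  · exact h i j

/-! ### Common refinements -/

/-- The tagged dissection `π` is refined by the first `N` cells of `ρ`, with `u k` the tag of the
cell of `π` which contains the `k`-th cell of `ρ`. -/
structure IsRefinement {a b : ℝ} (π : TaggedDissection a b) (ρ : ℕ → ℝ) (N : ℕ) (u : ℕ → ℝ) :
    Prop where
  mono : Monotone u
  mem : ∀ k, u k ∈ Set.Icc a b
  close : ∀ δ, π.MeshLT δ → ∀ k, |u k - ρ k| < δ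
  sum_eq : ∀ H : ℝ → ℝ → ℝ → ℝ, (∀ t x y z, H t x z = H t x y + H t y z) →
    ∑ i ∈ Finset.range π.n, H (π.tag i) (π.pt i) (π.pt (i + 1)) =
      ∑ k ∈ Finset.range N, H (u k) (ρ k) (ρ (k + 1))

theorem sum_Ico_additive {h : ℝ → ℝ → ℝ} (hadd : ∀ x y z, h x z = h x y + h y z) (ρ : ℕ → ℝ)
    {m n : ℕ} (hmn : m ≤ n) : ∑ k ∈ Finset.Ico m n, h (ρ k) (ρ (k + 1)) = h (ρ m) (ρ n) := by
  induction n, hmn using Nat.le_induction with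
  | base =>
    have := hadd (ρ m) (ρ m) (ρ m)
    simp only [Finset.Ico_self, Finset.sum_empty]
    linarith
  | succ n hn ih => rw [Finset.sum_Ico_succ_top hn, ih, ← hadd]

theorem exists_isRefinement {a b : ℝ} (hab : a < b) (π : TaggedDissection a b) {ρ : ℕ → ℝ} {N : ℕ}
    (hρ : Monotone ρ) (hρa : ρ 0 = a) (hρb : ∀ k, N ≤ k → ρ k = b)
    (hπ : ∀ i ≤ π.n, ∃ k ≤ N, ρ k = π.pt i) : ∃ u, IsRefinement π ρ N u := by
  have hn : 0 < π.n := by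
    rcases Nat.eq_zero_or_pos π.n with h | h
    · have h₁ := π.pt_last
      rw [h, π.pt_zero] at h₁
      exact absurd h₁ hab.ne
    · exact h
  have hex : ∀ i, ∃ k, π.pt (min i π.n) ≤ ρ k := fun i => by
    obtain ⟨k, -, hk⟩ := hπ (min i π.n) (min_le_right _ _)
    exact ⟨k, hk.ge⟩
  classical
  -- `σ i` is the first index at which `ρ` reaches `π.pt i`; clamping `i` at `π.n` ignores the
  -- points beyond the dissection.
  set σ : ℕ → ℕ := fun i => Nat.find (hex i) with hσdef
  have hσ : Monotone σ := fun i j hij =>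
    Nat.find_mono fun k hk => (π.mono (min_le_min_right _ hij)).trans hk
  have hσle : ∀ i, σ i ≤ N := fun i => by
    obtain ⟨k, hkN, hk⟩ := hπ (min i π.n) (min_le_right _ _)
    exact (Nat.find_min' (hex i) hk.ge).trans hkN
  have hσρ : ∀ i ≤ π.n, ρ (σ i) = π.pt i := fun i hi => by
    obtain ⟨k, hkN, hk⟩ := hπ (min i π.n) (min_le_right _ _)
    have h₁ : π.pt (min i π.n) ≤ ρ (σ i) := Nat.find_spec (hex i)
    have h₂ : ρ (σ i) ≤ ρ k := hρ (Nat.find_min' (hex i) hk.ge)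
    rw [hk] at h₂
    rw [min_eq_left hi] at h₁ h₂
    exact le_antisymm h₂ h₁
  have hσ₀ : σ 0 = 0 := by
    refine (Nat.find_eq_zero _).2 ?_
    rw [hρa, Nat.zero_min, π.pt_zero]
  -- `c k` is the cell of `π` assigned to `k`, capped at `π.n - 1` so that every `k`, even past `N`,
  -- gets a genuine tag.
  set c : ℕ → ℕ := fun k => Nat.findGreatest (fun i => σ i ≤ k) (π.n - 1) with hcdef
  have hc : ∀ k, c k ≤ π.n - 1 := fun k => Nat.findGreatest_le _
  have hcσ : ∀ k, σ (c k) ≤ k := fun k =>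
    Nat.findGreatest_spec (P := fun i => σ i ≤ k) (Nat.zero_le _) (by simp [hσ₀])
  have hcmono : Monotone c := fun k l hkl =>
    Nat.findGreatest_mono (fun i (hi : σ i ≤ k) => hi.trans hkl) le_rfl
  have hclt : ∀ k, c k < π.n := fun k => by have := hc k; omega
  have hcell : ∀ k, ρ k ∈ Set.Icc (π.pt (c k)) (π.pt (c k + 1)) := by
    intro k
    constructor
    · rw [← hσρ _ (hclt k).le]
      exact hρ (hcσ k)
    · rcases (hc k).eq_or_lt with h | h
      · rw [h, Nat.sub_add_cancel hn, π.pt_last, ← hρb (max k N) (le_max_right _ _)]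
        exact hρ (le_max_left _ _)
      · have := Nat.findGreatest_is_greatest (P := fun i => σ i ≤ k) (Nat.lt_succ_self (c k)) h
        rw [← hσρ (c k + 1) (hclt k)]
        exact hρ (not_le.1 this).le
  have htag : ∀ i j, i ≤ j → j < π.n → π.tag i ≤ π.tag j := by
    intro i j hij hj
    rcases hij.eq_or_lt with rfl | h
    · exact le_rfl
    · exact (π.tag_mem i (h.trans hj)).2.trans ((π.mono h).trans (π.tag_mem j hj).1)
  refine ⟨fun k => π.tag (c k), fun k l hkl => htag _ _ (hcmono hkl) (hclt l), fun k => ?_, ?_, ?_⟩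
  · have h₁ := π.tag_mem _ (hclt k)
    exact ⟨(π.pt_mem (hclt k).le).1.trans h₁.1, h₁.2.trans (π.pt_mem (hclt k)).2⟩
  · intro δ hδ k
    have h₁ := π.tag_mem _ (hclt k)
    have h₂ := hcell k
    have h₃ := hδ _ (hclt k)
    rw [abs_lt]
    constructor <;> linarith [h₁.1, h₁.2, h₂.1, h₂.2]
  · intro H hH
    have hpart : ∀ m ≤ π.n, ∑ i ∈ Finset.range m, H (π.tag i) (π.pt i) (π.pt (i + 1)) =
        ∑ k ∈ Finset.range (σ m), H (π.tag (c k)) (ρ k) (ρ (k + 1)) := by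
      intro m hm
      induction m with
      | zero => simp [hσ₀]
      | succ m ih =>
        rw [Finset.sum_range_succ, ih (by omega),
          ← Finset.sum_range_add_sum_Ico _ (hσ (Nat.le_succ m))]
        congr 1
        have hcm : ∀ k ∈ Finset.Ico (σ m) (σ (m + 1)),
            H (π.tag (c k)) (ρ k) (ρ (k + 1)) = H (π.tag m) (ρ k) (ρ (k + 1)) := by
          intro k hk
          rw [Finset.mem_Ico] at hk
          have h₁ : m ≤ c k :=
            Nat.le_findGreatest (P := fun i => σ i ≤ k) (by omega) hk.1
          have h₂ : c k ≤ m := by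
            by_contra h
            have h₃ : σ (m + 1) ≤ σ (c k) := hσ (by omega)
            have h₄ := hcσ k
            omega
          rw [le_antisymm h₂ h₁]
        rw [Nat.succ_eq_add_one, Finset.sum_congr rfl hcm,
          sum_Ico_additive (hH (π.tag m)) ρ (hσ (Nat.le_succ m)), Nat.succ_eq_add_one,
          hσρ m (by omega), hσρ (m + 1) hm]
    rw [hpart π.n le_rfl, ← Finset.sum_range_add_sum_Ico _ (hσle π.n)]
    -- From `σ π.n` on, `ρ` stays at `b`, and additivity forces `H t b b = 0`.
    have hzero : ∀ k ∈ Finset.Ico (σ π.n) N, H (π.tag (c k)) (ρ k) (ρ (k + 1)) = 0 := by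
      intro k hk
      rw [Finset.mem_Ico] at hk
      have hb : ρ (σ π.n) = b := by rw [hσρ _ le_rfl, π.pt_last]
      have hle : ∀ l, ρ l ≤ b := fun l => by
        rw [← hρb (max l N) (le_max_right _ _)]
        exact hρ (le_max_left _ _)
      have h₁ : ρ k = b := le_antisymm (hle k) (hb ▸ hρ hk.1)
      have h₂ : ρ (k + 1) = b := le_antisymm (hle _) (hb ▸ hρ (by omega))
      rw [h₁, h₂]
      have := hH (π.tag (c k)) b b b
      linarith
    rw [Finset.sum_eq_zero hzero, add_zero]

theorem exists_common_refinement {a b : ℝ} (hab : a < b) (π π' : TaggedDissection a b) :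
    ∃ (ρ : ℕ → ℝ) (N : ℕ) (u u' : ℕ → ℝ), Monotone ρ ∧ (∀ k, ρ k ∈ Set.Icc a b) ∧
      IsRefinement π ρ N u ∧ IsRefinement π' ρ N u' := by
  classical
  set D : Finset ℝ := (Finset.range (π.n + 1)).image π.pt ∪ (Finset.range (π'.n + 1)).image π'.pt
    with hD
  have hDmem : ∀ x ∈ D, x ∈ Set.Icc a b := by
    intro x hx
    rcases Finset.mem_union.1 hx with h | h
    · obtain ⟨i, hi, rfl⟩ := Finset.mem_image.1 h
      exact π.pt_mem (Nat.lt_succ_iff.1 (Finset.mem_range.1 hi))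
    · obtain ⟨i, hi, rfl⟩ := Finset.mem_image.1 h
      exact π'.pt_mem (Nat.lt_succ_iff.1 (Finset.mem_range.1 hi))
  have hπD : ∀ i ≤ π.n, π.pt i ∈ D := fun i hi =>
    Finset.mem_union_left _ (Finset.mem_image_of_mem _ (Finset.mem_range.2 (by omega)))
  have hπ'D : ∀ i ≤ π'.n, π'.pt i ∈ D := fun i hi =>
    Finset.mem_union_right _ (Finset.mem_image_of_mem _ (Finset.mem_range.2 (by omega)))
  have haD : a ∈ D := by simpa [π.pt_zero] using hπD 0 (Nat.zero_le _)
  have hbD : b ∈ D := by simpa [π.pt_last] using hπD π.n le_rfl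
  obtain ⟨N, hN⟩ : ∃ N, D.card = N + 1 :=
    Nat.exists_eq_succ_of_ne_zero (Finset.card_ne_zero_of_mem haD)
  set e := D.orderEmbOfFin hN
  set ρ : ℕ → ℝ := fun k => e ⟨min k N, by omega⟩ with hρdef
  have hρ : Monotone ρ := fun k l hkl =>
    e.monotone (by simpa using min_le_min_right N hkl)
  have hρD : ∀ k, ρ k ∈ D := fun k => Finset.orderEmbOfFin_mem D hN _
  have hsurj : ∀ x ∈ D, ∃ k ≤ N, ρ k = x := by
    intro x hx
    have : x ∈ Set.range e := by
      rw [Finset.range_orderEmbOfFin]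
      exact hx
    obtain ⟨i, rfl⟩ := this
    have hi : (i : ℕ) ≤ N := by omega
    exact ⟨i, hi, by simp [hρdef, min_eq_left hi]⟩
  have hρa : ρ 0 = a := by
    obtain ⟨k, -, hk⟩ := hsurj a haD
    exact le_antisymm (hk ▸ hρ (Nat.zero_le k)) (hDmem _ (hρD 0)).1
  have hρb : ∀ k, N ≤ k → ρ k = b := by
    intro k hk
    obtain ⟨l, hl, hlb⟩ := hsurj b hbD
    exact le_antisymm (hDmem _ (hρD k)).2 (hlb ▸ hρ (hl.trans hk))
  obtain ⟨u, hu⟩ := exists_isRefinement hab π hρ hρa hρb fun i hi => hsurj _ (hπD i hi)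
  obtain ⟨u', hu'⟩ := exists_isRefinement hab π' hρ hρa hρb fun i hi => hsurj _ (hπ'D i hi)
  exact ⟨ρ, N, u, u', hρ, fun k => hDmem _ (hρD k), hu, hu'⟩

/-! ### Comparison of Riemann sums -/

/-- The sum of `f g □R □S` over a grid, for double sequences with an additional first row and
column. -/
def gridSum (f g R S : ℕ → ℕ → ℝ) (n₁ n₂ n₃ n₄ : ℕ) : ℝ :=
  ∑ i ∈ Finset.range n₁, ∑ j ∈ Finset.range n₂, ∑ k ∈ Finset.range n₃, ∑ l ∈ Finset.range n₄,
    f (i + 1) (k + 1) * g (j + 1) (l + 1) * boxDiff R id id i j * boxDiff S id id k l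

/-- The summand is additive in each of the four cells, so the dissections can be refined one at a
time. -/
theorem riemannSum4_eq_gridSum (f g R : ℝ → ℝ → ℝ) {a₁ b₁ a₂ b₂ a₃ b₃ a₄ b₄ : ℝ}
    {π₁ : TaggedDissection a₁ b₁} {π₂ : TaggedDissection a₂ b₂}
    {π₃ : TaggedDissection a₃ b₃} {π₄ : TaggedDissection a₄ b₄}
    {ρ₁ ρ₂ ρ₃ ρ₄ u₁ u₂ u₃ u₄ : ℕ → ℝ} {n₁ n₂ n₃ n₄ : ℕ} (h₁ : IsRefinement π₁ ρ₁ n₁ u₁)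
    (h₂ : IsRefinement π₂ ρ₂ n₂ u₂) (h₃ : IsRefinement π₃ ρ₃ n₃ u₃)
    (h₄ : IsRefinement π₄ ρ₄ n₄ u₄) :
    riemannSum4 (fun s₁ s₂ s₃ s₄ => f s₁ s₃ * g s₂ s₄) R π₁ π₂ π₃ π₄ =
      gridSum (gridExt f u₁ u₃) (gridExt g u₂ u₄) (fun i j => R (ρ₁ i) (ρ₂ j))
        (fun k l => R (ρ₃ k) (ρ₄ l)) n₁ n₂ n₃ n₄ := by
  unfold riemannSum4 gridSum
  rw [h₁.sum_eq (fun t x y => ∑ j ∈ Finset.range π₂.n,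
    ∑ k ∈ Finset.range π₃.n, ∑ l ∈ Finset.range π₄.n,
      f t (π₃.tag k) * g (π₂.tag j) (π₄.tag l) *
        rectIncr R x y (π₂.pt j) (π₂.pt (j + 1)) *
        rectIncr R (π₃.pt k) (π₃.pt (k + 1)) (π₄.pt l) (π₄.pt (l + 1)))]
  swap
  · intro t x y z
    simp only [← Finset.sum_add_distrib, rectIncr]
    refine Finset.sum_congr rfl fun _ _ => Finset.sum_congr rfl fun _ _ =>
      Finset.sum_congr rfl fun _ _ => ?_
    ring
  refine Finset.sum_congr rfl fun i _ => ?_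
  rw [h₂.sum_eq (fun t x y =>
    ∑ k ∈ Finset.range π₃.n, ∑ l ∈ Finset.range π₄.n,
      f (u₁ i) (π₃.tag k) * g t (π₄.tag l) *
        rectIncr R (ρ₁ i) (ρ₁ (i + 1)) x y *
        rectIncr R (π₃.pt k) (π₃.pt (k + 1)) (π₄.pt l) (π₄.pt (l + 1)))]
  swap
  · intro t x y z
    simp only [← Finset.sum_add_distrib, rectIncr]
    refine Finset.sum_congr rfl fun _ _ => Finset.sum_congr rfl fun _ _ => ?_
    ring
  refine Finset.sum_congr rfl fun j _ => ?_
  rw [h₃.sum_eq (fun t x y => ∑ l ∈ Finset.range π₄.n,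
      f (u₁ i) t * g (u₂ j) (π₄.tag l) *
        rectIncr R (ρ₁ i) (ρ₁ (i + 1)) (ρ₂ j) (ρ₂ (j + 1)) *
        rectIncr R x y (π₄.pt l) (π₄.pt (l + 1)))]
  swap
  · intro t x y z
    simp only [← Finset.sum_add_distrib, rectIncr]
    refine Finset.sum_congr rfl fun _ _ => ?_
    ring
  refine Finset.sum_congr rfl fun k _ => ?_
  rw [h₄.sum_eq (fun t x y =>
      f (u₁ i) (u₃ k) * g (u₂ j) t *
        rectIncr R (ρ₁ i) (ρ₁ (i + 1)) (ρ₂ j) (ρ₂ (j + 1)) *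
        rectIncr R (ρ₃ k) (ρ₃ (k + 1)) x y)]
  · rfl
  · intro t x y z
    simp only [rectIncr]
    ring

theorem gridSum_sub (f f' g g' R S : ℕ → ℕ → ℝ) (n₁ n₂ n₃ n₄ : ℕ) :
    gridSum f g R S n₁ n₂ n₃ n₄ - gridSum f' g' R S n₁ n₂ n₃ n₄ =
      gridSum (f - f') g R S n₁ n₂ n₃ n₄ + gridSum f' (g - g') R S n₁ n₂ n₃ n₄ := by
  simp only [gridSum, ← Finset.sum_sub_distrib, ← Finset.sum_add_distrib, Pi.sub_apply]
  refine Finset.sum_congr rfl fun _ _ => Finset.sum_congr rfl fun _ _ =>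
    Finset.sum_congr rfl fun _ _ => Finset.sum_congr rfl fun _ _ => ?_
  ring

theorem IsRefinement.abs_sub_lt {a b δ : ℝ} {π π' : TaggedDissection a b} {ρ u u' : ℕ → ℝ} {N : ℕ}
    (h : IsRefinement π ρ N u) (h' : IsRefinement π' ρ N u') (hπ : π.MeshLT δ)
    (hπ' : π'.MeshLT δ) (k : ℕ) : |u k - u' k| < 2 * δ := by
  have h₁ := h.close δ hπ k
  have h₂ := h'.close δ hπ' k
  rw [abs_lt] at *
  constructor <;> linarith

theorem exists_mesh_enorm_sub_le {T : ℝ} {f : ℝ → ℝ → ℝ}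
    (hf : ContinuousOn (Function.uncurry f) (Set.Icc 0 T ×ˢ Set.Icc 0 T)) {η : ℝ} (hη : 0 < η) :
    ∃ δ > 0, ∀ s s' t t' : ℝ, s ∈ Set.Icc 0 T → s' ∈ Set.Icc 0 T → t ∈ Set.Icc 0 T →
      t' ∈ Set.Icc 0 T → |s - s'| < 2 * δ → |t - t'| < 2 * δ →
        ‖f s t - f s' t'‖ₑ ≤ ENNReal.ofReal η := by
  have huc := (isCompact_Icc.prod isCompact_Icc).uniformContinuousOn_of_continuous hf
  obtain ⟨δ, hδ, h⟩ := Metric.uniformContinuousOn_iff.1 huc η hη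
  refine ⟨δ / 2, by positivity, fun s s' t t' hs hs' ht ht' h₁ h₂ => ?_⟩
  rw [mul_div_cancel₀ δ two_ne_zero] at h₁ h₂
  have := h (s, t) ⟨hs, ht⟩ (s', t') ⟨hs', ht'⟩ (by
    rw [Prod.dist_eq, Real.dist_eq, Real.dist_eq]
    exact max_lt h₁ h₂)
  rw [Real.dist_eq] at this
  rw [Real.enorm_eq_ofReal_abs]
  exact ENNReal.ofReal_le_ofReal this.le

theorem exists_pos_ofReal_rpow_mul_lt {s : ℝ} (hs : 0 < s) {D : ℝ≥0∞} (hD : D < ∞) {ε : ℝ}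
    (hε : 0 < ε) : ∃ η : ℝ, 0 < η ∧ ENNReal.ofReal η ^ s * D < ENNReal.ofReal ε := by
  have h : Filter.Tendsto (fun η : ℝ => ENNReal.ofReal η ^ s * D) (nhdsWithin 0 (Set.Ioi 0))
      (nhds 0) := by
    have h₁ : Filter.Tendsto (fun η : ℝ => ENNReal.ofReal η ^ s) (nhds 0) (nhds 0) := by
      have := (ENNReal.continuous_rpow_const (y := s)).comp ENNReal.continuous_ofReal
      simpa [hs, Function.comp_def] using this.tendsto 0
    simpa using ENNReal.Tendsto.mul_const (h₁.mono_left nhdsWithin_le_nhds) (Or.inr hD.ne)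
  obtain ⟨η, h₁, h₂⟩ := ((h.eventually_lt_const (ENNReal.ofReal_pos.2 hε)).and
    self_mem_nhdsWithin).exists
  exact ⟨η, h₂, h₁⟩

/-- The Riemann sums along fine grids are uniformly close to each other. -/
theorem exists_mesh_riemannSum4_sub_lt {p q : ℝ} (hp : 1 ≤ p) (hq : 1 ≤ q)
    (hpq : 1 < 1 / p + 1 / q) {T : ℝ} {f g R : ℝ → ℝ → ℝ}
    (hf : ContinuousOn (Function.uncurry f) (Set.Icc 0 T ×ˢ Set.Icc 0 T))
    (hg : ContinuousOn (Function.uncurry g) (Set.Icc 0 T ×ˢ Set.Icc 0 T))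
    (hfv : FiniteVar2 p f T) (hgv : FiniteVar2 p g T) (hR : pVar2 q R 0 T 0 T < ∞)
    {a₁ b₁ a₂ b₂ a₃ b₃ a₄ b₄ : ℝ} (ha₁ : 0 ≤ a₁) (hab₁ : a₁ < b₁) (hb₁ : b₁ ≤ T)
    (ha₂ : 0 ≤ a₂) (hab₂ : a₂ < b₂) (hb₂ : b₂ ≤ T) (ha₃ : 0 ≤ a₃) (hab₃ : a₃ < b₃) (hb₃ : b₃ ≤ T)
    (ha₄ : 0 ≤ a₄) (hab₄ : a₄ < b₄) (hb₄ : b₄ ≤ T) {ε : ℝ} (hε : 0 < ε) :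
    ∃ δ > 0, ∀ (π₁ π₁' : TaggedDissection a₁ b₁) (π₂ π₂' : TaggedDissection a₂ b₂)
      (π₃ π₃' : TaggedDissection a₃ b₃) (π₄ π₄' : TaggedDissection a₄ b₄),
      π₁.MeshLT δ → π₁'.MeshLT δ → π₂.MeshLT δ → π₂'.MeshLT δ → π₃.MeshLT δ → π₃'.MeshLT δ →
      π₄.MeshLT δ → π₄'.MeshLT δ →
        |riemannSum4 (fun s₁ s₂ s₃ s₄ => f s₁ s₃ * g s₂ s₄) R π₁ π₂ π₃ π₄ -
          riemannSum4 (fun s₁ s₂ s₃ s₄ => f s₁ s₃ * g s₂ s₄) R π₁' π₂' π₃' π₄'| < ε := by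
  have hp₀ : 0 < p := by linarith
  have hq₀ : 0 < q := by linarith
  obtain ⟨p', hpp, hpq'⟩ : ∃ p', p < p' ∧ 1 < 1 / p' + 1 / q := by
    have h₁ : 1 / q ≤ 1 := by rw [div_le_one hq₀]; exact hq
    have h₂ : 0 < 1 / p := by positivity
    -- `1/p'` is the midpoint of `1 - 1/q` and `1/p`.
    refine ⟨1 / ((1 / p + (1 - 1 / q)) / 2), ?_, ?_⟩
    · rw [lt_one_div hp₀ (by linarith)]
      linarith
    · rw [one_div_one_div]
      linarith
  have hp₀' : 0 < p' := hp₀.trans hpp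
  have hs : 0 < (p' - p) / p' := div_pos (by linarith) hp₀'
  have ht : 0 ≤ p / p' := by positivity
  set s := (p' - p) / p'
  set K := fullVar2 p f a₁ b₁ a₃ b₃
  set L := fullVar2 p g a₂ b₂ a₄ b₄
  set M := pVar2 q R a₁ b₁ a₂ b₂
  set M' := pVar2 q R a₃ b₃ a₄ b₄
  have hK : K < ∞ := hfv.fullVar2_lt_top hp₀ ha₁ hab₁.le hb₁ ha₃ hab₃.le hb₃
  have hL : L < ∞ := hgv.fullVar2_lt_top hp₀ ha₂ hab₂.le hb₂ ha₄ hab₄.le hb₄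
  have hM : M < ∞ := (pVar2_mono hq₀ R ha₁ hb₁ ha₂ hb₂).trans_lt hR
  have hM' : M' < ∞ := (pVar2_mono hq₀ R ha₃ hb₃ ha₄ hb₄).trans_lt hR
  have hC := youngConst₄_lt_top hpq'
  obtain ⟨η, hη, hηε⟩ := exists_pos_ofReal_rpow_mul_lt hs
    (D := youngConst₄ p' q * ((K + K) ^ (p / p') * L * M * M' + K * (L + L) ^ (p / p') * M * M'))
    (by
      have h₁ := ENNReal.rpow_lt_top_of_nonneg ht (ENNReal.add_lt_top.2 ⟨hK, hK⟩).ne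
      have h₂ := ENNReal.rpow_lt_top_of_nonneg ht (ENNReal.add_lt_top.2 ⟨hL, hL⟩).ne
      exact ENNReal.mul_lt_top hC (ENNReal.add_lt_top.2
        ⟨ENNReal.mul_lt_top (ENNReal.mul_lt_top (ENNReal.mul_lt_top h₁ hL) hM) hM',
          ENNReal.mul_lt_top (ENNReal.mul_lt_top (ENNReal.mul_lt_top hK h₂) hM) hM'⟩)) hε
  -- A box increment involves four values, hence `η / 4`.
  obtain ⟨δ₁, hδ₁, hfδ⟩ := exists_mesh_enorm_sub_le hf (show 0 < η / 4 by positivity)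
  obtain ⟨δ₂, hδ₂, hgδ⟩ := exists_mesh_enorm_sub_le hg (show 0 < η / 4 by positivity)
  refine ⟨min δ₁ δ₂, lt_min hδ₁ hδ₂, ?_⟩
  intro π₁ π₁' π₂ π₂' π₃ π₃' π₄ π₄' m₁ m₁' m₂ m₂' m₃ m₃' m₄ m₄'
  obtain ⟨ρ₁, n₁, u₁, u₁', hρ₁, hρm₁, r₁, r₁'⟩ := exists_common_refinement hab₁ π₁ π₁'
  obtain ⟨ρ₂, n₂, u₂, u₂', hρ₂, hρm₂, r₂, r₂'⟩ := exists_common_refinement hab₂ π₂ π₂'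
  obtain ⟨ρ₃, n₃, u₃, u₃', hρ₃, hρm₃, r₃, r₃'⟩ := exists_common_refinement hab₃ π₃ π₃'
  obtain ⟨ρ₄, n₄, u₄, u₄', hρ₄, hρm₄, r₄, r₄'⟩ := exists_common_refinement hab₄ π₄ π₄'
  rw [riemannSum4_eq_gridSum f g R r₁ r₂ r₃ r₄, riemannSum4_eq_gridSum f g R r₁' r₂' r₃' r₄',
    gridSum_sub]
  have vf := mixedVarLE_gridExt hp hab₁.le hab₃.le f r₁.mono r₃.mono r₁.mem r₃.mem
  have vf' := mixedVarLE_gridExt hp hab₁.le hab₃.le f r₁'.mono r₃'.mono r₁'.mem r₃'.mem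
  have vg := mixedVarLE_gridExt hp hab₂.le hab₄.le g r₂.mono r₄.mono r₂.mem r₄.mem
  have vg' := mixedVarLE_gridExt hp hab₂.le hab₄.le g r₂'.mono r₄'.mono r₂'.mem r₄'.mem
  have vR := mixedVarLE_grid hq₀ R hρ₁ hρ₂ hρm₁ hρm₂
  have vS := mixedVarLE_grid hq₀ R hρ₃ hρ₄ hρm₃ hρm₄
  have four : 4 * ENNReal.ofReal (η / 4) = ENNReal.ofReal η := by
    rw [← ENNReal.ofReal_ofNat, ← ENNReal.ofReal_mul (by norm_num)]
    congr 1
    ring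
  have wf := (vf.sub hp vf').interpolate hp₀ hpp.le (η := ENNReal.ofReal η) (by
    rw [← four]
    refine enorm_boxDiff_le (enorm_gridExt_sub_le fun i j => ?_)
    refine hfδ _ _ _ _ (Set.Icc_subset_Icc ha₁ hb₁ (r₁.mem i)) (Set.Icc_subset_Icc ha₁ hb₁ (r₁'.mem i))
      (Set.Icc_subset_Icc ha₃ hb₃ (r₃.mem j)) (Set.Icc_subset_Icc ha₃ hb₃ (r₃'.mem j)) ?_ ?_
    · linarith [r₁.abs_sub_lt r₁' m₁ m₁' i, min_le_left δ₁ δ₂]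
    · linarith [r₃.abs_sub_lt r₃' m₃ m₃' j, min_le_left δ₁ δ₂])
  have wg := (vg.sub hp vg').interpolate hp₀ hpp.le (η := ENNReal.ofReal η) (by
    rw [← four]
    refine enorm_boxDiff_le (enorm_gridExt_sub_le fun i j => ?_)
    refine hgδ _ _ _ _ (Set.Icc_subset_Icc ha₂ hb₂ (r₂.mem i)) (Set.Icc_subset_Icc ha₂ hb₂ (r₂'.mem i))
      (Set.Icc_subset_Icc ha₄ hb₄ (r₄.mem j)) (Set.Icc_subset_Icc ha₄ hb₄ (r₄'.mem j)) ?_ ?_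
    · linarith [r₂.abs_sub_lt r₂' m₂ m₂' i, min_le_right δ₁ δ₂]
    · linarith [r₄.abs_sub_lt r₄' m₄ m₄' j, min_le_right δ₁ δ₂])
  have key₁ := young_four (hp.trans hpp.le) hq hpq' wf (vg.of_exponent_le hp₀ hpp.le) vR vS
    (by simp) (by simp) (by simp) (by simp) n₁ n₂ n₃ n₄
  have key₂ := young_four (hp.trans hpp.le) hq hpq' (vf'.of_exponent_le hp₀ hpp.le) wg vR vS
    (by simp) (by simp) (by simp) (by simp) n₁ n₂ n₃ n₄
  rw [← ENNReal.ofReal_lt_ofReal_iff hε, ← Real.enorm_eq_ofReal_abs]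
  refine lt_of_le_of_lt ((enorm_add_le _ _).trans (add_le_add key₁ key₂)) ?_
  refine lt_of_eq_of_lt ?_ hηε
  simp only [s, K, L, M, M']
  ring

/-- The Riemann sums are bounded by the variations. -/
theorem enorm_riemannSum4_le {p q : ℝ} (hp : 1 ≤ p) (hq : 1 ≤ q) (hpq : 1 < 1 / p + 1 / q)
    (f g R : ℝ → ℝ → ℝ) {a₁ b₁ a₂ b₂ a₃ b₃ a₄ b₄ : ℝ} (hab₁ : a₁ < b₁) (hab₂ : a₂ < b₂)
    (hab₃ : a₃ < b₃) (hab₄ : a₄ < b₄) (π₁ : TaggedDissection a₁ b₁) (π₂ : TaggedDissection a₂ b₂)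
    (π₃ : TaggedDissection a₃ b₃) (π₄ : TaggedDissection a₄ b₄) :
    ‖riemannSum4 (fun s₁ s₂ s₃ s₄ => f s₁ s₃ * g s₂ s₄) R π₁ π₂ π₃ π₄‖ₑ ≤
      youngConst₄ p q * (fullVar2 p f a₁ b₁ a₃ b₃ * fullVar2 p g a₂ b₂ a₄ b₄ *
        pVar2 q R a₁ b₁ a₂ b₂ * pVar2 q R a₃ b₃ a₄ b₄) := by
  have hq₀ : 0 < q := by linarith
  -- Refining `π₁` with itself provides globally monotone points and tags.
  obtain ⟨ρ₁, n₁, u₁, -, hρ₁, hρm₁, r₁, -⟩ := exists_common_refinement hab₁ π₁ π₁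
  obtain ⟨ρ₂, n₂, u₂, -, hρ₂, hρm₂, r₂, -⟩ := exists_common_refinement hab₂ π₂ π₂
  obtain ⟨ρ₃, n₃, u₃, -, hρ₃, hρm₃, r₃, -⟩ := exists_common_refinement hab₃ π₃ π₃
  obtain ⟨ρ₄, n₄, u₄, -, hρ₄, hρm₄, r₄, -⟩ := exists_common_refinement hab₄ π₄ π₄
  rw [riemannSum4_eq_gridSum f g R r₁ r₂ r₃ r₄]
  exact young_four hp hq hpq
    (mixedVarLE_gridExt hp hab₁.le hab₃.le f r₁.mono r₃.mono r₁.mem r₃.mem)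
    (mixedVarLE_gridExt hp hab₂.le hab₄.le g r₂.mono r₄.mono r₂.mem r₄.mem)
    (mixedVarLE_grid hq₀ R hρ₁ hρ₂ hρm₁ hρm₂) (mixedVarLE_grid hq₀ R hρ₃ hρ₄ hρm₃ hρm₄)
    (by simp) (by simp) (by simp) (by simp) n₁ n₂ n₃ n₄

/-! ### Existence of the integral -/

/-- The dissection of `[a, b]` into `n + 1` cells of the same length, tagged on the left. -/
def uniformDissection {a b : ℝ} (hab : a ≤ b) (n : ℕ) : TaggedDissection a b where
  n := n + 1
  pt k := a + (b - a) / (n + 1) * k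
  mono := fun k l hkl => by
    have : 0 ≤ (b - a) / (n + 1) := div_nonneg (by linarith) (by positivity)
    have : (k : ℝ) ≤ l := by exact_mod_cast hkl
    exact add_le_add le_rfl (mul_le_mul_of_nonneg_left this ‹_›)
  pt_zero := by simp
  pt_last := by
    push_cast
    field_simp
    ring
  tag k := a + (b - a) / (n + 1) * k
  tag_mem := fun i _ => by
    have : 0 ≤ (b - a) / (n + 1) := div_nonneg (by linarith) (by positivity)
    refine ⟨le_rfl, ?_⟩
    push_cast
    linarith

theorem eventually_uniformDissection_meshLT {a b : ℝ} (hab : a ≤ b) {δ : ℝ} (hδ : 0 < δ) :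
    ∀ᶠ n in Filter.atTop, (uniformDissection hab n).MeshLT δ := by
  have h : Filter.Tendsto (fun n : ℕ => (b - a) * (1 / ((n : ℝ) + 1))) Filter.atTop (nhds 0) := by
    simpa using tendsto_one_div_add_atTop_nhds_zero_nat.const_mul (b - a)
  filter_upwards [h.eventually_lt_const hδ] with n hn i _
  simp only [uniformDissection]
  push_cast
  rw [mul_one_div] at hn
  linarith

end Young4D

end

open Young4D in
theorem mainTheorem5 (p q : ℝ) (hp : 1 ≤ p) (hq : 1 ≤ q) (hpq : 1 < 1 / p + 1 / q) :
    ∃ C : ℝ≥0, ∀ (T : ℝ) (f g R : ℝ → ℝ → ℝ),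
      ContinuousOn (Function.uncurry f) (Set.Icc 0 T ×ˢ Set.Icc 0 T) →
      ContinuousOn (Function.uncurry g) (Set.Icc 0 T ×ˢ Set.Icc 0 T) →
      ContinuousOn (Function.uncurry R) (Set.Icc 0 T ×ˢ Set.Icc 0 T) →
      Young4D.FiniteVar2 p f T →
      Young4D.FiniteVar2 p g T →
      Young4D.pVar2 q R 0 T 0 T < ∞ →
      ∀ a₁ b₁ a₂ b₂ a₃ b₃ a₄ b₄ : ℝ,
        0 ≤ a₁ → a₁ < b₁ → b₁ ≤ T →
        0 ≤ a₂ → a₂ < b₂ → b₂ ≤ T →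
        0 ≤ a₃ → a₃ < b₃ → b₃ ≤ T →
        0 ≤ a₄ → a₄ < b₄ → b₄ ≤ T →
        ∃ I : ℝ,
          Young4D.IsYoungIntegral4 (fun s₁ s₂ s₃ s₄ => f s₁ s₃ * g s₂ s₄) R
            a₁ b₁ a₂ b₂ a₃ b₃ a₄ b₄ I ∧
          ‖I‖ₑ ≤ C * Young4D.pVar2 q R a₁ b₁ a₂ b₂ * Young4D.pVar2 q R a₃ b₃ a₄ b₄ *
            Young4D.fullVar2 p f a₁ b₁ a₃ b₃ * Young4D.fullVar2 p g a₂ b₂ a₄ b₄ := by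
  refine ⟨(youngConst₄ p q).toNNReal, ?_⟩
  intro T f g R hf hg _ hfv hgv hR a₁ b₁ a₂ b₂ a₃ b₃ a₄ b₄ ha₁ hab₁ hb₁ ha₂ hab₂ hb₂ ha₃ hab₃ hb₃
    ha₄ hab₄ hb₄
  have hcauchy := fun ε (hε : (0 : ℝ) < ε) => exists_mesh_riemannSum4_sub_lt hp hq hpq hf hg hfv hgv
    hR ha₁ hab₁ hb₁ ha₂ hab₂ hb₂ ha₃ hab₃ hb₃ ha₄ hab₄ hb₄ hε
  set U : ℕ → ℝ := fun n => riemannSum4 (fun s₁ s₂ s₃ s₄ => f s₁ s₃ * g s₂ s₄) R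
    (uniformDissection hab₁.le n) (uniformDissection hab₂.le n) (uniformDissection hab₃.le n)
    (uniformDissection hab₄.le n) with hU
  have hmesh : ∀ δ > 0, ∀ᶠ n in Filter.atTop, (uniformDissection hab₁.le n).MeshLT δ ∧
      (uniformDissection hab₂.le n).MeshLT δ ∧ (uniformDissection hab₃.le n).MeshLT δ ∧
      (uniformDissection hab₄.le n).MeshLT δ := fun δ hδ =>
    (eventually_uniformDissection_meshLT _ hδ).and ((eventually_uniformDissection_meshLT _ hδ).and
      ((eventually_uniformDissection_meshLT _ hδ).and (eventually_uniformDissection_meshLT _ hδ)))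
  have hUc : CauchySeq U := by
    refine Metric.cauchySeq_iff.2 fun ε hε => ?_
    obtain ⟨δ, hδ, h⟩ := hcauchy ε hε
    obtain ⟨n₀, hn₀⟩ := Filter.eventually_atTop.1 (hmesh δ hδ)
    refine ⟨n₀, fun m hm n hn => ?_⟩
    obtain ⟨h₁, h₂, h₃, h₄⟩ := hn₀ m hm
    obtain ⟨h₁', h₂', h₃', h₄'⟩ := hn₀ n hn
    exact h _ _ _ _ _ _ _ _ h₁ h₁' h₂ h₂' h₃ h₃' h₄ h₄'
  obtain ⟨I, hI⟩ := cauchySeq_tendsto_of_complete hUc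
  refine ⟨I, ?_, ?_⟩
  · intro ε hε
    obtain ⟨δ, hδ, h⟩ := hcauchy (ε / 2) (half_pos hε)
    refine ⟨δ, hδ, fun π₁ π₂ π₃ π₄ m₁ m₂ m₃ m₄ => ?_⟩
    refine lt_of_le_of_lt ?_ (half_lt_self hε)
    -- The uniform sums only serve to produce `I`: the Cauchy estimate against an arbitrary fine
    -- grid passes to their limit.
    refine le_of_tendsto (hI.const_sub _).abs ?_
    filter_upwards [hmesh δ hδ] with n hn
    exact (h _ _ _ _ _ _ _ _ m₁ hn.1 m₂ hn.2.1 m₃ hn.2.2.1 m₄ hn.2.2.2).le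
  · rw [ENNReal.coe_toNNReal (youngConst₄_lt_top hpq).ne]
    refine le_of_tendsto hI.enorm (Filter.Eventually.of_forall fun n => ?_)
    refine (enorm_riemannSum4_le hp hq hpq f g R hab₁ hab₂ hab₃ hab₄ _ _ _ _).trans (le_of_eq ?_)
    ring
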